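/- **Circuit and signal.** For real $\theta,\varphi,\chi,\omega$ let $$U=\begin{pmatrix} e^{-i\varphi}\cos\theta & -ie^{i\chi}\sin\theta\\ -ie^{-i\chi}\sin\theta & e^{i\varphi}\cos\theta\end{pmatrix},\qquad Z=\mathrm{diag}(1,-1),$$ and for a depth $n\in\mathbb N$ let $$p_{X,n}(\omega)=\bigl|\langle 0|(e^{i\omega Z}U)^n|{+}\rangle\bigr|^2,\qquad p_{Y,n}(\omega)=\bigl|\langle 0|(e^{i\omega Z}U)^n|\mathrm i\rangle\bigr|^2,$$ where $|+\rangle=(|0\rangle+|1\rangle)/\sqrt2$ and $|\mathrm i\rangle=(|0\rangle+i|1\rangle)/\sqrt2$. Put $\mathfrak h_n(\omega)=p_{X,n}(\omega)-\frac12+i\bigl(p_{Y,n}(\omega)-\frac12\bigr)$. **Estimator.** Let $d\ge1$ and $M\ge 1$ be integers. From measured amplitudes $F_n$, $n=d,d+2,\dots,3d$, form the differential signal $\vec\Gamma=(F_{d+2}-F_d,\,F_{d+4}-F_{d+2},\dots,F_{3d}-F_{3d-2})^\top\in\mathbb R^d$ and $$\hat\theta_{\mathrm{pd}}=\frac12\,\frac{\mathbb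 1^\top\mathfrak D^{-1}\vec\Gamma}{\mathbb 1^\top\mathfrak D^{-1}\mathbb 1},$$ where $\mathbb 1=(1,\dots,1)^\top\in\mathbb R^d$ and $\mathfrak D$ is the $d\times d$ discrete Laplacian ($2$ on the diagonal, $-1$ on the two neighbouring diagonals, $0$ elsewhere). **Theorem.** Let $\theta\ge0$ and $d\theta\le\frac19$. Let $\hat\varphi_{\mathrm{pri}}$ be a real random variable with finite variance and $\mathbb E\,\hat\varphi_{\mathrm{pri}}=\varphi$, and let all circuits be run at $\omega=\hat\varphi_{\mathrm{pri}}$. (1) Suppose the measured amplitudes are square-integrable and follow the linear noise model $F_n=|\mathfrak h_n(\hat\varphi_{\mathrm{pri}})|+w_n$ for $n=d,d+2,\dots,3d$, where, conditionally on $\hat\varphi_{\mathrm{pri}}$, the $w_n$ have mean $0$, are pairwise uncorrelated and have variance $\frac1{4M}$. Then $\hat\theta_{\mathrm{pd}}$ is square-integrable, $$\bigl|\mathbb E\,\hat\theta_{\mathrm{pd}}-\theta\bigr|\le\frac{13}{2}d^2\theta\,\mathrm{Var}(\hat\varphi_{\mathrm{pri}})+37(d\theta)^3,$$ and, almost surely,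 $$\mathrm{Var}\bigl(\hat\theta_{\mathrm{pd}}\,\big|\,\hat\varphi_{\mathrm{pri}}\bigr)=\frac{3}{4Md(d+1)(d+2)}.$$ (2) Suppose instead that $p^{\exp}_{X,n}$ and $p^{\exp}_{Y,n}$ are the frequencies of outcome $0$ in $M$ runs of each circuit, where, conditionally on $\hat\varphi_{\mathrm{pri}}$, any two distinct runs (of the same circuit or of two different ones) are independent, each with probability of outcome $0$ equal to $p_{X,n}(\hat\varphi_{\mathrm{pri}})$, respectively $p_{Y,n}(\hat\varphi_{\mathrm{pri}})$. Let $\mathfrak h^{\exp}_n=p^{\exp}_{X,n}-\frac12+i(p^{\exp}_{Y,n}-\frac12)$, and let the amplitudes be taken in the high signal-to-noise approximation $F_n=|\mathfrak h_n|+\mathrm{Re}\bigl(e^{-i\arg\mathfrak h_n}(\mathfrak h^{\exp}_n-\mathfrak h_n)\bigr)$ with $\mathfrak h_n=\mathfrak h_n(\hat\varphi_{\mathrm{pri}})$ and $\arg 0=0$. Then $\hat\theta_{\mathrm{pd}}$ is square-integrable, satisfies the same bias bound, and, almost surely, $$\bigl(1-36(d\theta)^2\bigr)\frac{3}{4Md(d+1)(d+2)}\le\mathrm{Var}\bigl(\hat\theta_{\mathrm{pd}}\,\big|\,\hat\varphi_{\mathrm{pri}}\bigr)\le\frac{3}{4Md(d+1)(d+2)}.$$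 -/

import Mathlib

open MeasureTheory ProbabilityTheory
open scoped Matrix

namespace QSPC

noncomputable section

/-- The FsimGate with swap angle `θ`, single-qubit phase `φ` and phase `χ`, restricted to the
single-excitation subspace with basis `|0_ℓ⟩ = |01⟩`, `|1_ℓ⟩ = |10⟩` (up to a global phase). -/
def fsim (θ φ χ : ℝ) : Matrix (Fin 2) (Fin 2) ℂ :=
  !![Complex.exp (-(Complex.I * φ)) * Real.cos θ,
      -Complex.I * Complex.exp (Complex.I * χ) * Real.sin θ;
    -Complex.I * Complex.exp (-(Complex.I * χ)) * Real.sin θ,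
      Complex.exp (Complex.I * φ) * Real.cos θ]

/-- The `Z`-rotation `e^{iωZ}`. -/
def zRot (ω : ℝ) : Matrix (Fin 2) (Fin 2) ℂ :=
  !![Complex.exp (Complex.I * ω), 0; 0, Complex.exp (-(Complex.I * ω))]

/-- The periodic circuit `(e^{iωZ} U_fsim)^n` of depth `n`. -/
def circuit (n : ℕ) (ω θ φ χ : ℝ) : Matrix (Fin 2) (Fin 2) ℂ :=
  (zRot ω * fsim θ φ χ) ^ n

/-- The two Bell input states: `X` stands for `|+_ℓ⟩` and `Y` for `|i_ℓ⟩`. -/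
inductive BellInput where
  | X : BellInput
  | Y : BellInput

/-- `|+_ℓ⟩ = (|0_ℓ⟩ + |1_ℓ⟩)/√2` and `|i_ℓ⟩ = (|0_ℓ⟩ + i|1_ℓ⟩)/√2`. -/
def BellInput.state : BellInput → (Fin 2 → ℂ)
  | .X => ((Real.sqrt 2 : ℝ) : ℂ)⁻¹ • ![1, 1]
  | .Y => ((Real.sqrt 2 : ℝ) : ℂ)⁻¹ • ![1, Complex.I]

/-- The probability `|⟨0_ℓ| (e^{iωZ} U_fsim)^n |ψ_b⟩|²` of measuring `0_ℓ` after the depth-`n`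
circuit with Bell input `b`; it is `p_X` for `b = X` and `p_Y` for `b = Y`. -/
def prob (b : BellInput) (n : ℕ) (ω θ φ χ : ℝ) : ℝ :=
  ‖(circuit n ω θ φ χ *ᵥ b.state) 0‖ ^ 2

/-- The complex number `p_X - 1/2 + i (p_Y - 1/2)` reconstructed from two probabilities. -/
def reconstruct (p : BellInput → ℝ) : ℂ :=
  ((p .X - 1 / 2 : ℝ) : ℂ) + Complex.I * ((p .Y - 1 / 2 : ℝ) : ℂ)

/-- The reconstructed function `𝔥_n(ω; θ, φ, χ)`. -/
def h (n : ℕ) (ω θ φ χ : ℝ) : ℂ :=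
  reconstruct fun b => prob b n ω θ φ χ

/-- The depths `d, d + 2, …, 3d`. -/
def depths (d : ℕ) : Finset ℕ := (Finset.range (d + 1)).image fun k => d + 2 * k

/-- The `d × d` discrete Laplacian: `2` on the diagonal, `-1` next to it, `0` elsewhere. -/
def laplacian (d : ℕ) : Matrix (Fin d) (Fin d) ℝ :=
  Matrix.of fun i j =>
    if i = j then 2 else if (i : ℕ) + 1 = j ∨ (j : ℕ) + 1 = i then -1 else 0

/-- The differential signal `Γ_k = F_{d+2k+2} - F_{d+2k}`, `k = 0, …, d - 1`, of amplitudes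
`F_n` measured at the depths `n`. -/
def diffSignal (d : ℕ) (F : ℕ → ℝ) : Fin d → ℝ :=
  fun k => F (d + 2 * (k + 1)) - F (d + 2 * k)

/-- The Laplacian-weighted estimator `(1/2) (𝟙ᵀ D⁻¹ Γ) / (𝟙ᵀ D⁻¹ 𝟙)` of the swap angle, as a
function of the measured amplitudes. -/
def thetaPd (d : ℕ) (F : ℕ → ℝ) : ℝ :=
  1 / 2 * (((1 : Fin d → ℝ) ⬝ᵥ ((laplacian d)⁻¹ *ᵥ diffSignal d F)) /
    ((1 : Fin d → ℝ) ⬝ᵥ ((laplacian d)⁻¹ *ᵥ (1 : Fin d → ℝ))))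

/-- The information carried by the prior estimator, i.e. the σ-algebra it generates. -/
abbrev sigmaOf {Ω : Type*} (φhat : Ω → ℝ) : MeasurableSpace Ω :=
  MeasurableSpace.comap φhat inferInstance

/-- The (random) noise `w_n = F_n - |𝔥_n(φhat)|` of measured amplitudes `F_n`, when the circuits
are run with modulation angle `ω = φhat`. -/
def ampNoise {Ω : Type*} (θ φ χ : ℝ) (φhat : Ω → ℝ) (F : ℕ → Ω → ℝ) (n : ℕ) (x : Ω) : ℝ :=
  F n x - ‖h n (φhat x) θ φ χ‖

/-- The linear noise model for the measured amplitudes `F_n`, `n = d, d + 2, …, 3d`, at modulation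
angle `ω = φhat`: `F_n = |𝔥_n(φhat)| + w_n`, where, given `φhat`, the noises `w_n` are centred,
pairwise uncorrelated, and have variance `1/(4M)`. -/
structure IsAmplitudeData {Ω : Type*} [MeasurableSpace Ω] (μ : Measure Ω) (d M : ℕ) (θ φ χ : ℝ)
    (φhat : Ω → ℝ) (F : ℕ → Ω → ℝ) : Prop where
  memLp : ∀ n ∈ depths d, MemLp (F n) 2 μ
  noise_mean : ∀ n ∈ depths d, μ[ampNoise θ φ χ φhat F n | sigmaOf φhat] =ᵐ[μ] 0
  noise_cov : ∀ n ∈ depths d, ∀ m ∈ depths d,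
    μ[fun x => ampNoise θ φ χ φhat F n x * ampNoise θ φ χ φhat F m x | sigmaOf φhat]
      =ᵐ[μ] fun _ => if n = m then 1 / (4 * (M : ℝ)) else 0

/-- The raw outcomes of the experiment: for each Bell input `b` and each depth `n = d, d + 2, …, 3d`
the circuit with modulation angle `ω = φhat` is run `M` times; `S b n i` is `1` if the `i`-th run
gives `0_ℓ` and `0` otherwise. Given `φhat`, each run has success probability `p_b` and distinct
runs are pairwise independent (for `0/1`-valued variables this is the product rule below). -/
structure IsShotRecord {Ω : Type*} [MeasurableSpace Ω] (μ : Measure Ω) (d M : ℕ) (θ φ χ : ℝ)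
    (φhat : Ω → ℝ) (S : BellInput → ℕ → Fin M → Ω → ℝ) : Prop where
  measurable : ∀ b, ∀ n ∈ depths d, ∀ i, Measurable (S b n i)
  zero_or_one : ∀ b, ∀ n ∈ depths d, ∀ i x, S b n i x = 0 ∨ S b n i x = 1
  prob_eq : ∀ b, ∀ n ∈ depths d, ∀ i,
    μ[S b n i | sigmaOf φhat] =ᵐ[μ] fun x => prob b n (φhat x) θ φ χ
  pair_indep : ∀ b, ∀ n ∈ depths d, ∀ i, ∀ b', ∀ n' ∈ depths d, ∀ i', (b, n, i) ≠ (b', n', i') →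
    μ[fun x => S b n i x * S b' n' i' x | sigmaOf φhat]
      =ᵐ[μ] fun x => prob b n (φhat x) θ φ χ * prob b' n' (φhat x) θ φ χ

/-- The measured complex signal `𝔥_n^exp = p_X^exp - 1/2 + i (p_Y^exp - 1/2)`, where `p_b^exp` is
the relative frequency of `0_ℓ` among the `M` runs. -/
def hExp {Ω : Type*} {M : ℕ} (S : BellInput → ℕ → Fin M → Ω → ℝ) (n : ℕ) (x : Ω) : ℂ :=
  reconstruct fun b => (∑ i, S b n i x) / (M : ℝ)

/-- The measured amplitude in the high signal-to-noise approximation, in which the amplitude noise is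
the real component of the complex noise in the frame of the noiseless signal:
`|𝔥_n| + Re (e^{-i arg 𝔥_n} (𝔥_n^exp - 𝔥_n))`. -/
def linAmp {Ω : Type*} {M : ℕ} (θ φ χ : ℝ) (φhat : Ω → ℝ) (S : BellInput → ℕ → Fin M → Ω → ℝ)
    (n : ℕ) (x : Ω) : ℝ :=
  ‖h n (φhat x) θ φ χ‖ +
    (Complex.exp (-(Complex.I * ((h n (φhat x) θ φ χ).arg : ℂ))) *
      (hExp S n x - h n (φhat x) θ φ χ)).re

end

end QSPC

/-!
The estimator is linear in the amplitudes. The vector `𝔇⁻¹ 𝟙` is the discrete parabola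
`(k + 1) (d - k) / 2`, so `thetaPd` is a weighted mean, with nonnegative weights, of the half
differences `(F_{n + 2} - F_n) / 2` (`thetaPd_eq_sum_diff`); summation by parts gives
`thetaPd = ∑ c_j F_{d + 2j}` with `c_j = 3 (2j - d) / (d (d + 1) (d + 2))` (`thetaPd_eq_sum`), and
`∑ c_j² = 3 / (d (d + 1) (d + 2))`.

Bias. Since the circuit is unitary, `𝔥_n = α β̄` for its first row `(α, β)`, hence `|𝔥_n|` and `|β|`
differ by at most `|β|³ ≤ (n θ)³`. By Cayley–Hamilton `|β| = sin θ |U_{n - 1}(x)|` at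
`x = cos θ cos (ω - φ)`. As `U_{n + 1} - U_{n - 1} = 2 T_{n + 1}`, half the difference of two
consecutive `|β|` is `sin θ T_{n + 1}(x)` as long as the `U`'s are nonnegative, and
`1 - T_m(x) ≤ m² (1 - x) ≤ m² (θ² + (ω - φ)²) / 2`. The `U`'s are nonnegative when
`d² (ω - φ)² < 4 / 13`; otherwise the trivial bound `2 θ` is already smaller than
`13 / 2 d² θ (ω - φ)²`. The resulting bound holds for each `ω`
(`abs_thetaPd_norm_h_sub_le`), and integrating it at `ω = φhat` gives the variance of `φhat`.

Variance. Given `φhat`, the estimator is a known signal plus a combination of centred, uncorrelated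
noises, so its conditional variance is the sum of the squared coefficients times the noise variances
(`memLp_integral_condVar_of_uncorrelated`). In the linear noise model the noises are those of the
amplitudes. For shot noise they are the individual runs, which enter with the coefficients
`cos t / M` and `sin t / M` where `𝔥_n = r e^{it}`; the noise of one amplitude then has variance
`(1/4 - r² (cos⁴ t + sin⁴ t)) / M`, with `r ≤ 3 d θ`.
-/

namespace QSPC

/-! ### The discrete Laplacian and the closed form of the estimator -/

/-- The Laplacian acts as the negative second difference on a sequence vanishing at both ends
`0` and `d + 1` (the Dirichlet boundary condition). -/
lemma laplacian_mulVec (d : ℕ) (f : ℕ → ℝ) (h0 : f 0 = 0) (h1 : f (d + 1) = 0) :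
    laplacian d *ᵥ (fun i : Fin d => f (i + 1))
      = fun i : Fin d => 2 * f (i + 1) - f i - f (i + 2) := by
  ext ⟨i, hi⟩
  have entry : ∀ j : Fin d, laplacian d ⟨i, hi⟩ j * f (j + 1)
      = 2 * (if (j : ℕ) = i then f (j + 1) else 0) - (if (j : ℕ) = i + 1 then f (j + 1) else 0)
        - (if (j : ℕ) + 1 = i then f (j + 1) else 0) := by
    rintro ⟨j, hj⟩
    simp only [laplacian, Matrix.of_apply, Fin.mk.injEq]
    split_ifs <;> first | omega | ring
  simp only [Matrix.mulVec, dotProduct, entry]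
  rw [Fin.sum_univ_eq_sum_range (fun j => 2 * (if j = i then f (j + 1) else 0)
    - (if j = i + 1 then f (j + 1) else 0) - (if j + 1 = i then f (j + 1) else 0)) d,
    Finset.sum_sub_distrib, Finset.sum_sub_distrib, ← Finset.mul_sum, Finset.sum_ite_eq',
    Finset.sum_ite_eq', if_pos (Finset.mem_range.2 hi)]
  have hr : (if i + 1 ∈ Finset.range d then f (i + 1 + 1) else 0) = f (i + 2) := by
    split_ifs with h
    · rfl
    · rw [Finset.mem_range] at h
      rw [show i + 2 = d + 1 by omega, h1]
  have hl : ∑ j ∈ Finset.range d, (if j + 1 = i then f (j + 1) else 0) = f i := by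
    cases i with
    | zero => simp [h0]
    | succ i =>
      simp only [Nat.add_right_cancel_iff]
      rw [Finset.sum_ite_eq', if_pos (Finset.mem_range.2 (by omega))]
  rw [hr, hl]
  ring

lemma isUnit_det_laplacian (d : ℕ) : IsUnit (laplacian d).det := by
  -- The columns of the inverse are the Green functions: tents with kink at `j + 1`.
  let g : ℕ → ℕ → ℝ := fun j t =>
    if t ≤ j + 1 then t * ((d : ℝ) - j) / (d + 1) else (j + 1) * ((d : ℝ) + 1 - t) / (d + 1)
  have hd : ((d : ℝ) + 1) ≠ 0 := by positivity
  have key : laplacian d * Matrix.of (fun i j : Fin d => g j (i + 1)) = 1 := by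
    ext i j
    have hcol := congrFun (laplacian_mulVec d (g j) (by simp [g])
      (by have := j.2; simp [g])) i
    rw [Matrix.mul_apply]
    simp only [Matrix.mulVec, dotProduct] at hcol
    simp only [Matrix.of_apply]
    rw [hcol, Matrix.one_apply]
    rcases lt_trichotomy (i : ℕ) j with h | h | h
    · rw [if_neg (by rintro rfl; omega)]
      simp only [g]
      rw [if_pos (by omega), if_pos (by omega), if_pos (by omega)]
      push_cast
      ring
    · rw [if_pos (Fin.ext h)]
      simp only [g]
      rw [if_pos (by omega), if_pos (by omega), if_neg (by omega), h]
      push_cast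
      field_simp
      ring
    · rw [if_neg (by rintro rfl; omega)]
      simp only [g]
      rcases Nat.eq_or_lt_of_le h with h' | h'
      · rw [if_neg (by omega), if_pos (by omega), if_neg (by omega), ← h']
        push_cast
        ring
      · rw [if_neg (by omega), if_neg (by omega), if_neg (by omega)]
        push_cast
        ring
  exact (Matrix.isUnit_iff_isUnit_det _).1 (IsUnit.of_mul_eq_one _ key)

/-- `𝔇⁻¹ 𝟙` is the discrete parabola. -/
lemma laplacian_inv_mulVec_one (d : ℕ) :
    (laplacian d)⁻¹ *ᵥ (1 : Fin d → ℝ) = fun k : Fin d => ((k : ℝ) + 1) * (d - k) / 2 := by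
  have h := laplacian_mulVec d (fun t => (t : ℝ) * (d + 1 - t) / 2) (by simp) (by simp)
  have h1 : laplacian d *ᵥ (fun k : Fin d => ((k : ℝ) + 1) * (d - k) / 2) = 1 := by
    convert h using 2
    · ext k
      push_cast
      ring
    · rw [Pi.one_apply]
      push_cast
      ring
  rw [← h1, Matrix.mulVec_mulVec, Matrix.nonsing_inv_mul _ (isUnit_det_laplacian d),
    Matrix.one_mulVec]

lemma laplacian_transpose (d : ℕ) : (laplacian d)ᵀ = laplacian d := by
  ext i j
  simp only [Matrix.transpose_apply, laplacian, Matrix.of_apply, eq_comm (a := j) (b := i),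
    or_comm (a := (j : ℕ) + 1 = i)]

lemma one_dotProduct_laplacian_inv (d : ℕ) (v : Fin d → ℝ) :
    (1 : Fin d → ℝ) ⬝ᵥ ((laplacian d)⁻¹ *ᵥ v) = ∑ k : Fin d, ((k : ℝ) + 1) * (d - k) / 2 * v k := by
  rw [Matrix.dotProduct_mulVec, ← Matrix.mulVec_transpose, Matrix.transpose_nonsing_inv,
    laplacian_transpose, laplacian_inv_mulVec_one]
  rfl

lemma sum_parabola (d : ℕ) :
    ∑ k ∈ Finset.range d, ((k : ℝ) + 1) * (d - k) / 2 = d * (d + 1) * (d + 2) / 12 := by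
  have h : ∀ N : ℕ, ∑ k ∈ Finset.range N, ((k : ℝ) + 1) * (d - k) / 2
      = N * (N + 1) * (3 * d - 2 * N + 2) / 12 := by
    intro N
    induction N with
    | zero => simp
    | succ N ih =>
      rw [Finset.sum_range_succ, ih]
      push_cast
      ring
  rw [h]
  ring

/-- The estimator is a parabolically weighted sum of the differential signal. -/
lemma thetaPd_eq_sum_diff (d : ℕ) (F : ℕ → ℝ) :
    thetaPd d F = 1 / 2 * ((∑ k ∈ Finset.range d, ((k : ℝ) + 1) * (d - k) / 2
      * (F (d + 2 * (k + 1)) - F (d + 2 * k))) / (d * (d + 1) * (d + 2) / 12)) := by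
  have h1 : (1 : Fin d → ℝ) ⬝ᵥ ((laplacian d)⁻¹ *ᵥ (1 : Fin d → ℝ))
      = d * (d + 1) * (d + 2) / 12 := by
    rw [one_dotProduct_laplacian_inv, ← sum_parabola]
    simp only [Pi.one_apply, mul_one]
    exact Fin.sum_univ_eq_sum_range (fun k => ((k : ℝ) + 1) * (d - k) / 2) d
  rw [thetaPd, h1, one_dotProduct_laplacian_inv]
  simp only [diffSignal]
  rw [Fin.sum_univ_eq_sum_range (fun k => ((k : ℝ) + 1) * (d - k) / 2
    * (F (d + 2 * (k + 1)) - F (d + 2 * k))) d]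

/-- The coefficient of the amplitude `F_{d + 2j}` in the estimator. -/
noncomputable def estCoeff (d j : ℕ) : ℝ :=
  3 * (2 * j - d) / (d * (d + 1) * (d + 2))

/-- Summation by parts turns the parabolic weights of the differences into linear weights of the
amplitudes. -/
lemma thetaPd_eq_sum (d : ℕ) (F : ℕ → ℝ) :
    thetaPd d F = ∑ j ∈ Finset.range (d + 1), estCoeff d j * F (d + 2 * j) := by
  have h : ∀ N : ℕ, ∑ k ∈ Finset.range N, ((k : ℝ) + 1) * (d - k) / 2
        * (F (d + 2 * (k + 1)) - F (d + 2 * k))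
      = ∑ j ∈ Finset.range N, (2 * (j : ℝ) - d) / 2 * F (d + 2 * j)
        + N * (d - N + 1) / 2 * F (d + 2 * N) := by
    intro N
    induction N with
    | zero => simp
    | succ N ih =>
      rw [Finset.sum_range_succ, ih, Finset.sum_range_succ]
      push_cast
      ring
  have h' : ∑ k ∈ Finset.range d, ((k : ℝ) + 1) * (d - k) / 2
        * (F (d + 2 * (k + 1)) - F (d + 2 * k))
      = ∑ j ∈ Finset.range (d + 1), (2 * (j : ℝ) - d) / 2 * F (d + 2 * j) := by
    rw [h, Finset.sum_range_succ]
    ring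
  rw [thetaPd_eq_sum_diff, h', Finset.sum_div, Finset.mul_sum]
  refine Finset.sum_congr rfl fun j _ => ?_
  simp only [estCoeff, div_eq_mul_inv, mul_inv]
  ring

lemma sum_estCoeff_sq (d : ℕ) (hd : 1 ≤ d) :
    ∑ j ∈ Finset.range (d + 1), estCoeff d j ^ 2 = 3 / (d * (d + 1) * (d + 2)) := by
  have h : ∀ N : ℕ, ∑ j ∈ Finset.range (N + 1), (2 * (j : ℝ) - d) ^ 2
      = 2 * (N : ℝ) * (N + 1) * (2 * N + 1) / 3 - 2 * d * N * (N + 1) + (N + 1) * (d : ℝ) ^ 2 := by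
    intro N
    induction N with
    | zero => simp
    | succ N ih =>
      rw [Finset.sum_range_succ, ih]
      push_cast
      ring
  have hd' : (d : ℝ) ≠ 0 := by positivity
  simp only [estCoeff, div_pow, mul_pow]
  rw [← Finset.sum_div, ← Finset.mul_sum, h]
  field_simp
  ring

/-- The weights of the half-differences are nonnegative and add up to `1`, so the estimator
inherits any error bound common to all half-differences. -/
lemma abs_thetaPd_sub_le (d : ℕ) (hd : 1 ≤ d) (F : ℕ → ℝ) (θ ε : ℝ)
    (h : ∀ k < d, |(F (d + 2 * (k + 1)) - F (d + 2 * k)) / 2 - θ| ≤ ε) :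
    |thetaPd d F - θ| ≤ ε := by
  have hd' : (0 : ℝ) < d := by positivity
  have hK : (0 : ℝ) < d * (d + 1) * (d + 2) / 12 := by positivity
  have e : thetaPd d F - θ = (∑ k ∈ Finset.range d, ((k : ℝ) + 1) * (d - k) / 2
      * ((F (d + 2 * (k + 1)) - F (d + 2 * k)) / 2 - θ)) / (d * (d + 1) * (d + 2) / 12) := by
    rw [thetaPd_eq_sum_diff, eq_div_iff hK.ne']
    simp only [mul_sub _ _ θ]
    rw [Finset.sum_sub_distrib, ← Finset.sum_mul, sum_parabola, sub_mul, mul_assoc,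
      div_mul_cancel₀ _ hK.ne', Finset.mul_sum]
    congr 1
    · exact Finset.sum_congr rfl fun k _ => by ring
    · ring
  rw [e, abs_div, abs_of_pos hK, div_le_iff₀ hK]
  refine (Finset.abs_sum_le_sum_abs _ _).trans ?_
  rw [← sum_parabola, Finset.mul_sum]
  refine Finset.sum_le_sum fun k hk => ?_
  have hk' : (k : ℝ) < d := by exact_mod_cast Finset.mem_range.1 hk
  have hw : 0 ≤ ((k : ℝ) + 1) * (d - k) / 2 :=
    div_nonneg (mul_nonneg (by positivity) (by linarith)) (by norm_num)
  rw [abs_mul, abs_of_nonneg hw, mul_comm ε]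
  exact mul_le_mul_of_nonneg_left (h k (Finset.mem_range.1 hk)) hw

/-! ### The amplitude of the noiseless signal -/

open Polynomial in
/-- By Cayley–Hamilton, the powers of a `2 × 2` matrix of determinant one obey the recursion of the
Chebyshev polynomials of the second kind in half the trace. -/
lemma pow_succ_eq_chebyshev {R : Type*} [CommRing R] (A : Matrix (Fin 2) (Fin 2) R) (x : R)
    (hdet : A.det = 1) (htr : A.trace = 2 * x) (n : ℕ) :
    A ^ (n + 1) = (Chebyshev.U R n).eval x • A
      - (Chebyshev.U R ((n : ℤ) - 1)).eval x • (1 : Matrix (Fin 2) (Fin 2) R) := by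
  have hA : A * A = (2 * x) • A - 1 := by
    rw [Matrix.det_fin_two] at hdet
    rw [Matrix.trace_fin_two] at htr
    rw [← htr]
    ext i j
    fin_cases i <;> fin_cases j <;> simp [Matrix.mul_apply, Fin.sum_univ_two] <;>
      first | ring1 | linear_combination (-1) * hdet
  induction n with
  | zero => simp
  | succ n ih =>
    rw [pow_succ, ih, sub_mul, smul_mul_assoc, hA, smul_mul_assoc, one_mul]
    push_cast
    rw [Chebyshev.U_add_one, add_sub_cancel_right]
    simp only [eval_sub, eval_mul, eval_ofNat, eval_X]
    module

lemma zRot_mem_unitaryGroup (ω : ℝ) : zRot ω ∈ Matrix.unitaryGroup (Fin 2) ℂ := by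
  rw [Matrix.mem_unitaryGroup_iff]
  have h := Complex.exp_add (Complex.I * ω) (-(Complex.I * ω))
  rw [add_neg_cancel, Complex.exp_zero] at h
  ext i j
  fin_cases i <;> fin_cases j <;>
    simp [zRot, Matrix.mul_apply, Matrix.star_apply, Fin.sum_univ_two, ← Complex.exp_conj] <;>
    linear_combination (-1) * h

lemma fsim_mem_unitaryGroup (θ φ χ : ℝ) : fsim θ φ χ ∈ Matrix.unitaryGroup (Fin 2) ℂ := by
  rw [Matrix.mem_unitaryGroup_iff]
  have h1 := Complex.exp_add (Complex.I * φ) (-(Complex.I * φ))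
  have h2 := Complex.exp_add (Complex.I * χ) (-(Complex.I * χ))
  rw [add_neg_cancel, Complex.exp_zero] at h1 h2
  have h3 := Complex.sin_sq_add_cos_sq θ
  have hI := Complex.I_sq
  have hs : (starRingEnd ℂ) (Complex.sin θ) = Complex.sin θ := by
    rw [← Complex.ofReal_sin, Complex.conj_ofReal]
  have hc : (starRingEnd ℂ) (Complex.cos θ) = Complex.cos θ := by
    rw [← Complex.ofReal_cos, Complex.conj_ofReal]
  ext i j
  fin_cases i <;> fin_cases j <;>
    simp [fsim, Matrix.mul_apply, Matrix.star_apply, Fin.sum_univ_two, ← Complex.exp_conj, hs, hc]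
  all_goals
    generalize Complex.exp (Complex.I * φ) = a at *
    generalize Complex.exp (-(Complex.I * φ)) = a' at *
    generalize Complex.exp (Complex.I * χ) = b at *
    generalize Complex.exp (-(Complex.I * χ)) = b' at *
    generalize Complex.sin θ = s at *
    generalize Complex.cos θ = c at *
  · linear_combination h3 - c ^ 2 * h1 - s ^ 2 * h2 - b * b' * s ^ 2 * hI
  · ring
  · ring
  · linear_combination h3 - c ^ 2 * h1 - s ^ 2 * h2 - b * b' * s ^ 2 * hI

lemma circuit_mem_unitaryGroup (n : ℕ) (ω θ φ χ : ℝ) :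
    circuit n ω θ φ χ ∈ Matrix.unitaryGroup (Fin 2) ℂ :=
  pow_mem (mul_mem (zRot_mem_unitaryGroup ω) (fsim_mem_unitaryGroup θ φ χ)) n

lemma norm_sq_circuit_row (n : ℕ) (ω θ φ χ : ℝ) :
    ‖circuit n ω θ φ χ 0 0‖ ^ 2 + ‖circuit n ω θ φ χ 0 1‖ ^ 2 = 1 := by
  have h := congrFun (congrFun
    ((Matrix.mem_unitaryGroup_iff).1 (circuit_mem_unitaryGroup n ω θ φ χ)) 0) 0
  simp only [Matrix.mul_apply, Fin.sum_univ_two, Matrix.star_apply, Matrix.one_apply_eq,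
    RCLike.star_def, Complex.mul_conj'] at h
  exact_mod_cast h

/-- The signal is the product of the first-row entries of the circuit, the second one conjugated. -/
lemma h_eq_mul_conj (n : ℕ) (ω θ φ χ : ℝ) :
    h n ω θ φ χ = circuit n ω θ φ χ 0 0 * (starRingEnd ℂ) (circuit n ω θ φ χ 0 1) := by
  have hu := norm_sq_circuit_row n ω θ φ χ
  have h2 : (Real.sqrt 2)⁻¹ ^ 2 = 1 / 2 := by
    rw [inv_pow, Real.sq_sqrt (by norm_num)]
    norm_num
  have h2' : ‖(((Real.sqrt 2 : ℝ) : ℂ))⁻¹‖ ^ 2 = 1 / 2 := by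
    rw [norm_inv, Complex.norm_real, Real.norm_of_nonneg (Real.sqrt_nonneg 2), h2]
  rw [h, reconstruct, prob, prob]
  simp only [BellInput.state, Matrix.mulVec_smul, Pi.smul_apply, norm_smul, mul_pow, h2']
  simp only [Matrix.mulVec, dotProduct, Fin.sum_univ_two, Matrix.cons_val_zero, Matrix.cons_val_one,
    mul_one]
  generalize circuit n ω θ φ χ 0 0 = a at *
  generalize circuit n ω θ φ χ 0 1 = b at *
  simp only [← Complex.normSq_eq_norm_sq, Complex.normSq_apply] at *
  apply Complex.ext <;> simp <;> linear_combination (1 / 2) * hu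

lemma norm_h (n : ℕ) (ω θ φ χ : ℝ) :
    ‖h n ω θ φ χ‖ = ‖circuit n ω θ φ χ 0 0‖ * ‖circuit n ω θ φ χ 0 1‖ := by
  rw [h_eq_mul_conj, norm_mul, RCLike.norm_conj]

lemma norm_h_le (n : ℕ) (ω θ φ χ : ℝ) : ‖h n ω θ φ χ‖ ≤ ‖circuit n ω θ φ χ 0 1‖ := by
  have hu := norm_sq_circuit_row n ω θ φ χ
  rw [norm_h]
  refine mul_le_of_le_one_left (norm_nonneg _) ?_
  nlinarith [sq_nonneg ‖circuit n ω θ φ χ 0 1‖, norm_nonneg (circuit n ω θ φ χ 0 0)]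

/-- With `norm_h_le`: the amplitude agrees with the modulus of the off-diagonal entry up to third
order, because the first row is a unit vector. -/
lemma sub_cube_le_norm_h (n : ℕ) (ω θ φ χ : ℝ) :
    ‖circuit n ω θ φ χ 0 1‖ - ‖circuit n ω θ φ χ 0 1‖ ^ 3 ≤ ‖h n ω θ φ χ‖ := by
  have hu := norm_sq_circuit_row n ω θ φ χ
  rw [norm_h]
  have ha := norm_nonneg (circuit n ω θ φ χ 0 0)
  have hb := norm_nonneg (circuit n ω θ φ χ 0 1)
  generalize ‖circuit n ω θ φ χ 0 0‖ = a at *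
  generalize ‖circuit n ω θ φ χ 0 1‖ = b at *
  have ha1 : a ≤ 1 := by nlinarith [sq_nonneg b]
  -- `1 - a ≤ 1 - a ^ 2 = b ^ 2`
  have : a ^ 2 ≤ a := by nlinarith
  nlinarith [mul_le_mul_of_nonneg_left this hb]

open Polynomial in
/-- The determinant of `e^{iωZ} U` is one and half its trace is `cos θ cos (ω - φ)`, so the
off-diagonal entry of its `n`-th power is a Chebyshev multiple of the one of `e^{iωZ} U`. -/
lemma norm_circuit_zero_one (n : ℕ) (ω θ φ χ : ℝ) :
    ‖circuit n ω θ φ χ 0 1‖ = |Real.sin θ|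
      * |(Chebyshev.U ℝ ((n : ℤ) - 1)).eval (Real.cos θ * Real.cos (ω - φ))| := by
  have hA : ‖(zRot ω * fsim θ φ χ) 0 1‖ = |Real.sin θ| := by
    have e : ∀ t : ℝ, ‖Complex.exp (Complex.I * t)‖ = 1 := fun t => by
      rw [mul_comm, Complex.norm_exp_ofReal_mul_I]
    simp only [zRot, fsim, Matrix.mul_apply, Fin.sum_univ_two, Matrix.of_apply, Matrix.cons_val',
      Matrix.cons_val_zero, Matrix.cons_val_one, zero_mul, add_zero, norm_mul, e, norm_neg,
      Complex.norm_I, one_mul, Complex.norm_real, Real.norm_eq_abs]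
  have h1 := Complex.exp_add (Complex.I * φ) (-(Complex.I * φ))
  have h2 := Complex.exp_add (Complex.I * χ) (-(Complex.I * χ))
  have h4 := Complex.exp_add (Complex.I * ω) (-(Complex.I * ω))
  rw [add_neg_cancel, Complex.exp_zero] at h1 h2 h4
  have h3 := Complex.sin_sq_add_cos_sq θ
  have hI := Complex.I_sq
  have hdet : (zRot ω * fsim θ φ χ).det = 1 := by
    rw [Matrix.det_mul, zRot, fsim, Matrix.det_fin_two_of, Matrix.det_fin_two_of]
    push_cast
    generalize Complex.exp (Complex.I * φ) = a at *
    generalize Complex.exp (-(Complex.I * φ)) = a' at *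
    generalize Complex.exp (Complex.I * χ) = b at *
    generalize Complex.exp (-(Complex.I * χ)) = b' at *
    generalize Complex.exp (Complex.I * ω) = w at *
    generalize Complex.exp (-(Complex.I * ω)) = w' at *
    generalize Complex.sin θ = s at *
    generalize Complex.cos θ = c at *
    linear_combination h3 - c ^ 2 * h1 - s ^ 2 * h2 - b * b' * s ^ 2 * hI
      - (a * a' * c ^ 2 - Complex.I ^ 2 * b * b' * s ^ 2) * h4
  have htr : (zRot ω * fsim θ φ χ).trace
      = 2 * ((Real.cos θ * Real.cos (ω - φ) : ℝ) : ℂ) := by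
    have e1 : Complex.exp (Complex.I * ω) * Complex.exp (-(Complex.I * φ))
        = Complex.exp ((ω - φ : ℂ) * Complex.I) := by
      rw [← Complex.exp_add]
      ring_nf
    have e2 : Complex.exp (-(Complex.I * ω)) * Complex.exp (Complex.I * φ)
        = Complex.exp (-(ω - φ : ℂ) * Complex.I) := by
      rw [← Complex.exp_add]
      ring_nf
    have e3 := Complex.two_cos (ω - φ : ℂ)
    simp only [Matrix.trace_fin_two, zRot, fsim, Matrix.mul_apply, Fin.sum_univ_two,
      Matrix.of_apply, Matrix.cons_val', Matrix.cons_val_zero, Matrix.cons_val_one, zero_mul,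
      add_zero, zero_add]
    push_cast
    linear_combination Complex.cos θ * (e1 + e2 - e3)
  cases n with
  | zero => simp [circuit]
  | succ n =>
    rw [circuit, pow_succ_eq_chebyshev _ _ hdet htr, Matrix.sub_apply, Matrix.smul_apply,
      Matrix.smul_apply, Matrix.one_apply_ne (by decide), smul_zero, sub_zero,
      ← Chebyshev.complex_ofReal_eval_U, smul_eq_mul, norm_mul, hA, Complex.norm_real,
      Real.norm_eq_abs, mul_comm]
    push_cast
    rw [add_sub_cancel_right]

/-! ### The pointwise bias bound -/

section Chebyshev

open Polynomial

lemma abs_sin_nat_mul_le (m : ℕ) (y : ℝ) : |Real.sin (m * y)| ≤ m * |Real.sin y| := by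
  induction m with
  | zero => simp
  | succ m ih =>
    have e : Real.sin ((m + 1 : ℕ) * y)
        = Real.sin (m * y) * Real.cos y + Real.cos (m * y) * Real.sin y := by
      rw [← Real.sin_add]
      push_cast
      ring_nf
    rw [e]
    refine (abs_add_le _ _).trans ?_
    rw [abs_mul, abs_mul]
    have h1 := mul_le_mul_of_nonneg_left (Real.abs_cos_le_one y) (abs_nonneg (Real.sin (m * y)))
    have h2 := mul_le_mul_of_nonneg_right (Real.abs_cos_le_one (m * y)) (abs_nonneg (Real.sin y))
    push_cast
    linarith

/-- Half-angle form of `|sin (m σ / 2)| ≤ m |sin (σ / 2)|` at `x = cos σ`. -/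
lemma one_sub_eval_chebyshevT_le (m : ℕ) {x : ℝ} (hx : |x| ≤ 1) :
    1 - (Chebyshev.T ℝ m).eval x ≤ (m : ℝ) ^ 2 * (1 - x) := by
  obtain ⟨h1, h2⟩ := abs_le.1 hx
  obtain ⟨σ, rfl⟩ : ∃ σ, Real.cos σ = x := ⟨_, Real.cos_arccos h1 h2⟩
  rw [Chebyshev.T_real_cos]
  have half : ∀ t : ℝ, 1 - Real.cos t = 2 * Real.sin (t / 2) ^ 2 := fun t => by
    have := Real.cos_two_mul (t / 2)
    rw [mul_div_cancel₀ t two_ne_zero] at this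
    have := Real.sin_sq_add_cos_sq (t / 2)
    linarith
  rw [half, half]
  have h := abs_sin_nat_mul_le m (σ / 2)
  have h' := pow_le_pow_left₀ (abs_nonneg _) h 2
  rw [mul_pow, sq_abs, sq_abs, ← mul_div_assoc] at h'
  push_cast
  linarith

lemma abs_eval_chebyshevU_le (n : ℕ) {x : ℝ} (hx : |x| ≤ 1) :
    |(Chebyshev.U ℝ ((n : ℤ) - 1)).eval x| ≤ n := by
  induction n with
  | zero => simp
  | succ n ih =>
    have e := congrArg (eval x) (Chebyshev.U_eq_X_mul_U_add_T ℝ ((n : ℤ) - 1))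
    rw [sub_add_cancel, eval_add, eval_mul, eval_X] at e
    push_cast
    rw [add_sub_cancel_right, e]
    refine (abs_add_le _ _).trans ?_
    rw [abs_mul]
    have h1 := mul_le_mul_of_nonneg_right hx
      (abs_nonneg ((Chebyshev.U ℝ ((n : ℤ) - 1)).eval x))
    have h2 := Chebyshev.abs_eval_T_real_le_one (n : ℤ) hx
    linarith

/-- The Chebyshev form of `sin ((n + 2) σ) - sin (n σ) = 2 cos ((n + 1) σ) sin σ`. -/
lemma eval_chebyshevU_sub (n : ℕ) (x : ℝ) :
    (Chebyshev.U ℝ (((n + 2 : ℕ) : ℤ) - 1)).eval x - (Chebyshev.U ℝ ((n : ℤ) - 1)).eval x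
      = 2 * (Chebyshev.T ℝ ((n + 1 : ℕ) : ℤ)).eval x := by
  have e1 := congrArg (eval x) (Chebyshev.U_add_one ℝ (n : ℤ))
  have e2 := congrArg (eval x) (Chebyshev.U_eq_X_mul_U_add_T ℝ (n : ℤ))
  rw [eval_sub, eval_mul, eval_mul, eval_ofNat, eval_X] at e1
  rw [eval_add, eval_mul, eval_X] at e2
  rw [show (((n + 2 : ℕ) : ℤ) - 1) = (n : ℤ) + 1 by push_cast; ring]
  push_cast
  linarith

lemma eval_chebyshevU_nonneg (n : ℕ) {σ : ℝ} (h0 : 0 ≤ σ) (hσ : n * σ < Real.pi) :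
    0 ≤ (Chebyshev.U ℝ ((n : ℤ) - 1)).eval (Real.cos σ) := by
  rcases Nat.eq_zero_or_pos n with rfl | hn
  · simp
  rcases h0.eq_or_lt with rfl | hpos
  · rw [Real.cos_zero, Chebyshev.U_eval_one]
    simp
  have hn' : (1 : ℝ) ≤ n := by exact_mod_cast hn
  have hlt : σ < Real.pi := by nlinarith
  have h := Chebyshev.U_real_cos σ ((n : ℤ) - 1)
  push_cast at h
  rw [sub_add_cancel] at h
  have hs : 0 < Real.sin σ := Real.sin_pos_of_pos_of_lt_pi hpos hlt
  have hn0 : 0 ≤ Real.sin (n * σ) := Real.sin_nonneg_of_nonneg_of_le_pi (by positivity) hσ.le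
  rw [← h] at hn0
  exact nonneg_of_mul_nonneg_left hn0 hs

end Chebyshev

lemma abs_cos_mul_cos_le_one (θ δ : ℝ) : |Real.cos θ * Real.cos δ| ≤ 1 := by
  rw [abs_mul]
  exact mul_le_one₀ (Real.abs_cos_le_one _) (abs_nonneg _) (Real.abs_cos_le_one _)

lemma one_sub_cos_mul_cos_le (θ δ : ℝ) :
    1 - Real.cos θ * Real.cos δ ≤ (θ ^ 2 + δ ^ 2) / 2 := by
  have h1 := Real.one_sub_sq_div_two_le_cos (x := θ)
  have h2 := Real.one_sub_sq_div_two_le_cos (x := δ)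
  nlinarith [mul_nonneg (sub_nonneg.2 (Real.cos_le_one θ)) (sub_nonneg.2 (Real.cos_le_one δ))]

lemma norm_circuit_zero_one_le (n : ℕ) (ω θ φ χ : ℝ) (hθ : 0 ≤ θ) :
    ‖circuit n ω θ φ χ 0 1‖ ≤ n * θ := by
  rw [norm_circuit_zero_one, mul_comm (n : ℝ)]
  refine mul_le_mul ?_ (abs_eval_chebyshevU_le n (abs_cos_mul_cos_le_one _ _)) (abs_nonneg _) hθ
  simpa [abs_of_nonneg hθ] using Real.abs_sin_le_abs (x := θ)

/-- Half the difference of the moduli of the off-diagonal entries estimates `θ`. For large detuning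
`ω - φ` the trivial bound by `2θ` suffices; for small detuning the Chebyshev values are nonnegative,
and half the difference is exactly `sin θ · T_{n + 1}`. -/
lemma abs_half_diff_norm_circuit_sub_le (d n : ℕ) (hd : 1 ≤ d) (hn : n + 2 ≤ 3 * d) (ω θ φ χ : ℝ)
    (hθ : 0 ≤ θ) (hdθ : (d : ℝ) * θ ≤ 1 / 9) :
    |(‖circuit (n + 2) ω θ φ χ 0 1‖ - ‖circuit n ω θ φ χ 0 1‖) / 2 - θ|
      ≤ 13 / 2 * (d : ℝ) ^ 2 * θ * (ω - φ) ^ 2 + 5 * ((d : ℝ) * θ) ^ 3 := by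
  have hd' : (1 : ℝ) ≤ d := by exact_mod_cast hd
  have hn' : (n : ℝ) + 2 ≤ 3 * d := by exact_mod_cast hn
  have hdθ0 : 0 ≤ (d : ℝ) * θ := by positivity
  have hθ1 : θ ≤ d * θ := le_mul_of_one_le_left hθ hd'
  have hs0 : 0 ≤ Real.sin θ :=
    Real.sin_nonneg_of_nonneg_of_le_pi hθ (by linarith [Real.pi_gt_three])
  have hs1 : Real.sin θ ≤ θ := Real.sin_le hθ
  rw [norm_circuit_zero_one, norm_circuit_zero_one, abs_of_nonneg hs0]
  generalize ω - φ = δ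
  have hx := abs_cos_mul_cos_le_one θ δ
  have hx' := one_sub_cos_mul_cos_le θ δ
  obtain ⟨hx1, hx2⟩ := abs_le.1 hx
  generalize Real.cos θ * Real.cos δ = x at *
  have hdiff := eval_chebyshevU_sub n x
  have hT := Polynomial.Chebyshev.abs_eval_T_real_le_one ((n + 1 : ℕ) : ℤ) hx
  have hT' := one_sub_eval_chebyshevT_le (n + 1) hx
  have hpos : ∀ k : ℕ, k * Real.arccos x < Real.pi →
      0 ≤ (Polynomial.Chebyshev.U ℝ ((k : ℤ) - 1)).eval x := fun k hk => by
    have := eval_chebyshevU_nonneg k (Real.arccos_nonneg x) hk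
    rwa [Real.cos_arccos hx1 hx2] at this
  generalize (Polynomial.Chebyshev.T ℝ ((n + 1 : ℕ) : ℤ)).eval x = T at *
  obtain ⟨hT1, hT2⟩ := abs_le.1 hT
  have hcube : 0 ≤ ((d : ℝ) * θ) ^ 3 := by positivity
  -- The threshold is where the trivial error `2θ` equals `13 / 2 d² θ δ²`.
  by_cases hδ : 4 / 13 ≤ (d : ℝ) ^ 2 * δ ^ 2
  · generalize (Polynomial.Chebyshev.U ℝ (((n + 2 : ℕ) : ℤ) - 1)).eval x = u at *
    generalize (Polynomial.Chebyshev.U ℝ ((n : ℤ) - 1)).eval x = v at *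
    have huv : |(|u| - |v|)| ≤ 2 := by
      refine (abs_abs_sub_abs_le_abs_sub u v).trans ?_
      rw [hdiff, abs_mul, abs_two]
      linarith
    have hb : |(Real.sin θ * |u| - Real.sin θ * |v|) / 2| ≤ θ := by
      rw [← mul_sub, abs_div, abs_mul, abs_of_nonneg hs0, abs_two]
      have := mul_le_mul hs1 huv (abs_nonneg _) hθ
      linarith
    have hmain : 2 * θ ≤ 13 / 2 * (d : ℝ) ^ 2 * θ * δ ^ 2 := by
      have := mul_le_mul_of_nonneg_right hδ hθ
      linarith
    obtain ⟨hb1, hb2⟩ := abs_le.1 hb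
    exact abs_le.2 ⟨by linarith, by linarith⟩
  · rw [not_le] at hδ
    have hdθsq : (d : ℝ) ^ 2 * θ ^ 2 ≤ 1 / 81 := by
      have := pow_le_pow_left₀ hdθ0 hdθ 2
      rw [mul_pow] at this
      linarith
    -- Here `(k σ)² ≤ π² · 9/4 · (1/81 + 4/13) < π²` for `σ = arccos x` and `k ≤ 3d`.
    have harc : ∀ k : ℕ, (k : ℝ) ≤ 3 * d → k * Real.arccos x < Real.pi := by
      intro k hk
      have h := Real.cos_le_one_sub_mul_cos_sq (x := Real.arccos x)
        (by rw [abs_of_nonneg (Real.arccos_nonneg x)]; exact Real.arccos_le_pi x)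
      rw [Real.cos_arccos hx1 hx2] at h
      have h2 : 2 / Real.pi ^ 2 * Real.arccos x ^ 2 ≤ (θ ^ 2 + δ ^ 2) / 2 := by linarith
      have hpi := Real.pi_pos
      have h3 : Real.arccos x ^ 2 ≤ Real.pi ^ 2 * ((θ ^ 2 + δ ^ 2) / 4) := by
        rw [div_mul_eq_mul_div, div_le_iff₀ (by positivity)] at h2
        linarith
      have h4 : (k : ℝ) ^ 2 ≤ 9 * (d : ℝ) ^ 2 := by
        have := pow_le_pow_left₀ (by positivity) hk 2
        rw [mul_pow] at this
        linarith
      refine lt_of_pow_lt_pow_left₀ 2 hpi.le ?_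
      calc ((k : ℝ) * Real.arccos x) ^ 2 = (k : ℝ) ^ 2 * Real.arccos x ^ 2 := mul_pow _ _ _
        _ ≤ 9 * (d : ℝ) ^ 2 * (Real.pi ^ 2 * ((θ ^ 2 + δ ^ 2) / 4)) :=
          mul_le_mul h4 h3 (sq_nonneg _) (by positivity)
        _ = Real.pi ^ 2 * (9 / 4 * ((d : ℝ) ^ 2 * θ ^ 2 + (d : ℝ) ^ 2 * δ ^ 2)) := by ring
        _ < Real.pi ^ 2 * 1 := mul_lt_mul_of_pos_left (by linarith) (by positivity)
        _ = Real.pi ^ 2 := mul_one _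
    rw [abs_of_nonneg (hpos (n + 2) (harc _ (by push_cast; linarith))),
      abs_of_nonneg (hpos n (harc _ (by linarith))), ← mul_sub, hdiff]
    have hsin : θ - θ ^ 3 / 6 ≤ Real.sin θ := Real.sin_ge_sub_cube hθ
    have hθ3 : θ ^ 3 ≤ ((d : ℝ) * θ) ^ 3 := pow_le_pow_left₀ hθ hθ1 3
    have hT3 : 1 - T ≤ 9 * (d : ℝ) ^ 2 * ((θ ^ 2 + δ ^ 2) / 2) := by
      refine hT'.trans (mul_le_mul ?_ hx' (by linarith) (by positivity))
      have := pow_le_pow_left₀ (by positivity) (show ((n + 1 : ℕ) : ℝ) ≤ 3 * d by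
        push_cast; linarith) 2
      rw [mul_pow] at this
      linarith
    have hsT : Real.sin θ * (1 - T) ≤ θ * (9 * (d : ℝ) ^ 2 * ((θ ^ 2 + δ ^ 2) / 2)) :=
      mul_le_mul hs1 hT3 (by linarith) hθ
    have hd3 : (d : ℝ) ^ 2 * θ ^ 3 ≤ ((d : ℝ) * θ) ^ 3 := by
      rw [mul_pow]
      exact mul_le_mul_of_nonneg_right (pow_le_pow_right₀ hd' (by norm_num)) (by positivity)
    have hdd : 0 ≤ (d : ℝ) ^ 2 * θ * δ ^ 2 := by positivity
    have hup : Real.sin θ * T ≤ θ := by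
      have := mul_le_mul_of_nonneg_left hT2 hs0
      linarith
    exact abs_le.2 ⟨by linarith, by linarith⟩

/-- The error of the estimator evaluated on the noiseless amplitudes. Replacing an amplitude by the
modulus of the off-diagonal entry costs at most `(3 d θ)³ = 27 (d θ)³`. -/
lemma abs_thetaPd_norm_h_sub_le (d : ℕ) (hd : 1 ≤ d) (ω θ φ χ : ℝ) (hθ : 0 ≤ θ)
    (hdθ : (d : ℝ) * θ ≤ 1 / 9) :
    |thetaPd d (fun n => ‖h n ω θ φ χ‖) - θ|
      ≤ 13 / 2 * (d : ℝ) ^ 2 * θ * (ω - φ) ^ 2 + 37 * ((d : ℝ) * θ) ^ 3 := by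
  refine abs_thetaPd_sub_le d hd _ _ _ fun k hk => ?_
  have hdk : d + 2 * k + 2 ≤ 3 * d := by omega
  have hmain := abs_half_diff_norm_circuit_sub_le d (d + 2 * k) hd hdk ω θ φ χ hθ hdθ
  have hcube : ∀ n : ℕ, n ≤ 3 * d → ‖circuit n ω θ φ χ 0 1‖ ^ 3 ≤ 27 * ((d : ℝ) * θ) ^ 3 := by
    intro n hn
    have hn' : (n : ℝ) ≤ 3 * d := by exact_mod_cast hn
    have h1 := (norm_circuit_zero_one_le n ω θ φ χ hθ).trans (mul_le_mul_of_nonneg_right hn' hθ)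
    have h2 := pow_le_pow_left₀ (norm_nonneg _) h1 3
    rw [mul_assoc, mul_pow] at h2
    linarith
  have c1 := hcube (d + 2 * k) (by omega)
  have c2 := hcube (d + 2 * k + 2) hdk
  have u1 := norm_h_le (d + 2 * k) ω θ φ χ
  have u2 := norm_h_le (d + 2 * k + 2) ω θ φ χ
  have l1 := sub_cube_le_norm_h (d + 2 * k) ω θ φ χ
  have l2 := sub_cube_le_norm_h (d + 2 * k + 2) ω θ φ χ
  have hpos : 0 ≤ ((d : ℝ) * θ) ^ 3 := by positivity
  obtain ⟨m1, m2⟩ := abs_le.1 hmain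
  rw [show d + 2 * (k + 1) = d + 2 * k + 2 by ring]
  exact abs_le.2 ⟨by linarith, by linarith⟩

/-! ### Conditional moments of linear combinations of uncorrelated noises -/

section CondVar

variable {Ω ι : Type*} {m m0 : MeasurableSpace Ω} {μ : Measure Ω} [IsProbabilityMeasure μ]

/-- A signal `A` known given `m`, plus a combination of conditionally centred and uncorrelated
noises `w k` of conditional variance `v k`, with bounded coefficients `a k` known given `m`. The
conditional variance of the sum only sees the squared coefficients. -/
lemma memLp_integral_condVar_of_uncorrelated [DecidableEq ι] (hm : m ≤ m0) (s : Finset ι)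
    {Y A : Ω → ℝ} {a w v : ι → Ω → ℝ} (C : ℝ)
    (hY : Y = fun x => A x + ∑ k ∈ s, a k x * w k x)
    (hA : StronglyMeasurable[m] A) (hA2 : MemLp A 2 μ)
    (ha : ∀ k ∈ s, StronglyMeasurable[m] (a k)) (haC : ∀ k ∈ s, ∀ x, |a k x| ≤ C)
    (hw2 : ∀ k ∈ s, MemLp (w k) 2 μ) (hw : ∀ k ∈ s, μ[w k | m] =ᵐ[μ] 0)
    (hcov : ∀ k ∈ s, ∀ l ∈ s,
      μ[fun x => w k x * w l x | m] =ᵐ[μ] fun x => if k = l then v k x else 0) :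
    MemLp Y 2 μ ∧ ∫ x, Y x ∂μ = ∫ x, A x ∂μ ∧
      Var[Y; μ | m] =ᵐ[μ] fun x => ∑ k ∈ s, a k x ^ 2 * v k x := by
  have haw2 : ∀ k ∈ s, MemLp (fun x => a k x * w k x) 2 μ := fun k hk =>
    (hw2 k hk).mul' (memLp_top_of_bound ((ha k hk).mono hm).aestronglyMeasurable C
      (Filter.Eventually.of_forall (haC k hk)))
  have hN2 : MemLp (fun x => ∑ k ∈ s, a k x * w k x) 2 μ := memLp_finsetSum s haw2
  have hY2 : MemLp Y 2 μ := hY ▸ hA2.add hN2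
  have haw0 : ∀ k ∈ s, μ[fun x => a k x * w k x | m] =ᵐ[μ] 0 := by
    intro k hk
    have h := condExp_mul_of_stronglyMeasurable_left (ha k hk)
      ((haw2 k hk).integrable one_le_two) ((hw2 k hk).integrable one_le_two)
    filter_upwards [h, hw k hk] with x hx hx0
    refine hx.trans ?_
    rw [Pi.mul_apply, hx0]
    simp
  have hN0 : μ[fun x => ∑ k ∈ s, a k x * w k x | m] =ᵐ[μ] 0 := by
    have h := condExp_finsetSum (m := m) (fun k hk => (haw2 k hk).integrable one_le_two)
    have h0 : ∀ᵐ x ∂μ, ∀ k ∈ s, (μ[fun x => a k x * w k x | m]) x = 0 :=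
      (Finset.eventually_all s).2 haw0
    have e : (∑ k ∈ s, fun x => a k x * w k x) = fun x => ∑ k ∈ s, a k x * w k x := by
      ext x
      simp
    rw [e] at h
    filter_upwards [h, h0] with x hx hx0
    rw [hx, Finset.sum_apply, Finset.sum_eq_zero hx0, Pi.zero_apply]
  have hYm : μ[Y | m] =ᵐ[μ] A := by
    have h := condExp_add (hA2.integrable one_le_two) (hN2.integrable one_le_two) m
    rw [condExp_of_stronglyMeasurable hm hA (hA2.integrable one_le_two)] at h
    filter_upwards [h, hN0] with x hx hx0
    rw [hY]
    refine hx.trans ?_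
    rw [Pi.add_apply, hx0, Pi.zero_apply, add_zero]
  refine ⟨hY2, ?_, ?_⟩
  · rw [← integral_condExp hm, integral_congr_ae hYm]
  · have hsq : (Y - μ[Y | m]) ^ 2
        =ᵐ[μ] ∑ p ∈ s ×ˢ s, fun x => (a p.1 x * a p.2 x) * (w p.1 x * w p.2 x) := by
      filter_upwards [hYm] with x hx
      rw [Pi.pow_apply, Pi.sub_apply, hx, hY, Finset.sum_apply, add_sub_cancel_left, sq,
        Finset.sum_mul_sum, Finset.sum_product]
      exact Finset.sum_congr rfl fun k _ => Finset.sum_congr rfl fun l _ => by ring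
    have hww : ∀ p ∈ s ×ˢ s, Integrable (fun x => w p.1 x * w p.2 x) μ := fun p hp =>
      (hw2 _ (Finset.mem_product.1 hp).1).integrable_mul (hw2 _ (Finset.mem_product.1 hp).2)
    have haaww : ∀ p ∈ s ×ˢ s,
        Integrable (fun x => (a p.1 x * a p.2 x) * (w p.1 x * w p.2 x)) μ := fun p hp => by
      have := (haw2 _ (Finset.mem_product.1 hp).1).integrable_mul
        (haw2 _ (Finset.mem_product.1 hp).2)
      refine this.congr (Filter.Eventually.of_forall fun x => ?_)
      simp only [Pi.mul_apply]
      ring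
    have hterm : ∀ p ∈ s ×ˢ s, ∀ᵐ x ∂μ,
        (μ[fun x => (a p.1 x * a p.2 x) * (w p.1 x * w p.2 x) | m]) x
          = (a p.1 x * a p.2 x) * if p.1 = p.2 then v p.1 x else 0 := fun p hp => by
      obtain ⟨h1, h2⟩ := Finset.mem_product.1 hp
      filter_upwards [condExp_mul_of_stronglyMeasurable_left ((ha _ h1).mul (ha _ h2))
        (haaww p hp) (hww p hp), hcov _ h1 _ h2] with x hx hx'
      refine hx.trans ?_
      rw [Pi.mul_apply, hx', Pi.mul_apply]
    have hall := (Finset.eventually_all (s ×ˢ s)).2 hterm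
    filter_upwards [condExp_congr_ae (m := m) hsq, condExp_finsetSum (m := m) haaww, hall]
      with x hx1 hx2 hx3
    rw [condVar, hx1, hx2, Finset.sum_apply, Finset.sum_congr rfl hx3, Finset.sum_product]
    refine Finset.sum_congr rfl fun k hk => ?_
    simp only [mul_ite, mul_zero]
    rw [Finset.sum_ite_eq, if_pos hk, sq]

/-- Conditional covariance of two bounded variables from the conditional means `p`, `p'` and the
conditional mean `q` of the product. -/
lemma condExp_centred_mul
    (hm : m ≤ m0) {X X' p p' q : Ω → ℝ} (hX : MemLp X 2 μ) (hX' : MemLp X' 2 μ)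
    (hp : StronglyMeasurable[m] p) (hp' : StronglyMeasurable[m] p') (hp2 : MemLp p 2 μ)
    (hp2' : MemLp p' 2 μ) (h : μ[X | m] =ᵐ[μ] p) (h' : μ[X' | m] =ᵐ[μ] p')
    (hq : μ[fun x => X x * X' x | m] =ᵐ[μ] q) :
    μ[fun x => (X x - p x) * (X' x - p' x) | m] =ᵐ[μ] fun x => q x - p x * p' x := by
  have i1 : Integrable (X * X') μ := hX.integrable_mul hX'
  have i2 : Integrable (p * X') μ := hp2.integrable_mul hX'
  have i3 : Integrable (p' * (X - p)) μ := hp2'.integrable_mul (hX.sub hp2)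
  have e : (fun x => (X x - p x) * (X' x - p' x)) = X * X' - p * X' - p' * (X - p) := by
    ext x
    simp only [Pi.sub_apply, Pi.mul_apply]
    ring
  rw [e]
  filter_upwards [condExp_sub (i1.sub i2) i3 m, condExp_sub i1 i2 m,
    condExp_mul_of_stronglyMeasurable_left hp i2 (hX'.integrable one_le_two),
    condExp_mul_of_stronglyMeasurable_left hp' i3 ((hX.sub hp2).integrable one_le_two),
    condExp_sub (hX.integrable one_le_two) (hp2.integrable one_le_two) m, h, h', hq]
    with x h1 h2 h3 h4 h5 h6 h7 h8
  rw [condExp_of_stronglyMeasurable hm hp (hp2.integrable one_le_two)] at h5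
  rw [h1, Pi.sub_apply, h2, Pi.sub_apply, h3, h4, Pi.mul_apply, Pi.mul_apply, h5, Pi.sub_apply, h6,
    h7, sub_self, mul_zero, sub_zero]
  exact congrArg (· - p x * p' x) h8

end CondVar

/-! ### Shot noise in the frame of the noiseless signal -/

/-- The components of the unit vector `e^{i arg z}`: the weights with which the errors of `p_X` and
`p_Y` enter the amplitude noise. -/
noncomputable def frameCoeff : BellInput → ℂ → ℝ
  | .X, z => Real.cos z.arg
  | .Y, z => Real.sin z.arg

lemma abs_frameCoeff_le_one (b : BellInput) (z : ℂ) : |frameCoeff b z| ≤ 1 := by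
  cases b
  · exact Real.abs_cos_le_one _
  · exact Real.abs_sin_le_one _

lemma measurable_frameCoeff (b : BellInput) : Measurable (frameCoeff b) := by
  cases b
  · exact Real.measurable_cos.comp Complex.measurable_arg
  · exact Real.measurable_sin.comp Complex.measurable_arg

/-- The probabilities in polar coordinates of the signal. -/
lemma prob_eq_half_add (b : BellInput) (n : ℕ) (ω θ φ χ : ℝ) :
    prob b n ω θ φ χ = 1 / 2 + ‖h n ω θ φ χ‖ * frameCoeff b (h n ω θ φ χ) := by
  cases b
  · rw [frameCoeff, Complex.norm_mul_cos_arg]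
    simp [h, reconstruct]
  · rw [frameCoeff, Complex.norm_mul_sin_arg]
    simp [h, reconstruct]

lemma norm_h_le_one (n : ℕ) (ω θ φ χ : ℝ) : ‖h n ω θ φ χ‖ ≤ 1 := by
  have hu := norm_sq_circuit_row n ω θ φ χ
  refine (norm_h_le n ω θ φ χ).trans ?_
  nlinarith [sq_nonneg ‖circuit n ω θ φ χ 0 0‖, norm_nonneg (circuit n ω θ φ χ 0 1)]

lemma abs_prob_le_two (b : BellInput) (n : ℕ) (ω θ φ χ : ℝ) : |prob b n ω θ φ χ| ≤ 2 := by
  have h1 := mul_le_mul (norm_h_le_one n ω θ φ χ) (abs_frameCoeff_le_one b (h n ω θ φ χ))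
    (abs_nonneg _) zero_le_one
  rw [prob_eq_half_add]
  refine (abs_add_le _ _).trans ?_
  rw [abs_mul, abs_norm, abs_of_nonneg (by norm_num : (0 : ℝ) ≤ 1 / 2)]
  linarith

lemma linAmp_eq {Ω : Type*} {M : ℕ} (hM : 1 ≤ M) (θ φ χ : ℝ) (φhat : Ω → ℝ)
    (S : BellInput → ℕ → Fin M → Ω → ℝ) (n : ℕ) (x : Ω) :
    linAmp θ φ χ φhat S n x = ‖h n (φhat x) θ φ χ‖
      + (∑ i, frameCoeff .X (h n (φhat x) θ φ χ) / M * (S .X n i x - prob .X n (φhat x) θ φ χ)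
        + ∑ i, frameCoeff .Y (h n (φhat x) θ φ χ) / M
          * (S .Y n i x - prob .Y n (φhat x) θ φ χ)) := by
  have hM' : (M : ℝ) ≠ 0 := by positivity
  have hre : ∀ b, ∑ i, frameCoeff b (h n (φhat x) θ φ χ) / M
        * (S b n i x - prob b n (φhat x) θ φ χ)
      = frameCoeff b (h n (φhat x) θ φ χ)
        * ((∑ i, S b n i x) / M - prob b n (φhat x) θ φ χ) := fun b => by
    rw [← Finset.mul_sum, Finset.sum_sub_distrib, Finset.sum_const, Finset.card_univ,
      Fintype.card_fin, nsmul_eq_mul]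
    field_simp
  have hdiff : hExp S n x - h n (φhat x) θ φ χ
      = (((∑ i, S .X n i x) / M - prob .X n (φhat x) θ φ χ : ℝ) : ℂ)
        + (((∑ i, S .Y n i x) / M - prob .Y n (φhat x) θ φ χ : ℝ) : ℂ) * Complex.I := by
    simp only [hExp, h, reconstruct]
    push_cast
    ring
  have hexp : ∀ t : ℝ, Complex.exp (-(Complex.I * t))
      = (Real.cos t : ℂ) - (Real.sin t : ℂ) * Complex.I := fun t => by
    rw [← neg_mul, mul_comm, mul_neg, ← neg_mul, Complex.exp_mul_I, Complex.cos_neg,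
      Complex.sin_neg]
    push_cast
    ring
  rw [linAmp, hre, hre, hdiff, hexp, frameCoeff, frameCoeff]
  congr 1
  simp only [Complex.mul_re, Complex.mul_im, Complex.sub_re, Complex.sub_im, Complex.add_re,
    Complex.add_im, Complex.ofReal_re, Complex.ofReal_im, Complex.I_re, Complex.I_im]
  ring

/-- The conditional variance of the shot noise in the amplitude at depth `n`, times `M`. -/
noncomputable def shotVar (n : ℕ) (ω θ φ χ : ℝ) : ℝ :=
  frameCoeff .X (h n ω θ φ χ) ^ 2 * (prob .X n ω θ φ χ * (1 - prob .X n ω θ φ χ))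
    + frameCoeff .Y (h n ω θ φ χ) ^ 2 * (prob .Y n ω θ φ χ * (1 - prob .Y n ω θ φ χ))

/-- In polar coordinates `𝔥 = r e^{it}` the shot variance is `1/4 - r² (cos⁴ t + sin⁴ t)`. -/
lemma shotVar_eq (n : ℕ) (ω θ φ χ : ℝ) :
    shotVar n ω θ φ χ = 1 / 4 - ‖h n ω θ φ χ‖ ^ 2
      * (Real.cos (h n ω θ φ χ).arg ^ 4 + Real.sin (h n ω θ φ χ).arg ^ 4) := by
  have hcs := Real.sin_sq_add_cos_sq (h n ω θ φ χ).arg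
  rw [shotVar, prob_eq_half_add, prob_eq_half_add, frameCoeff, frameCoeff]
  linear_combination (1 / 4) * hcs

lemma shotVar_le (n : ℕ) (ω θ φ χ : ℝ) : shotVar n ω θ φ χ ≤ 1 / 4 := by
  rw [shotVar_eq]
  have : 0 ≤ ‖h n ω θ φ χ‖ ^ 2
      * (Real.cos (h n ω θ φ χ).arg ^ 4 + Real.sin (h n ω θ φ χ).arg ^ 4) := by positivity
  linarith

lemma le_shotVar (d n : ℕ) (hn : n ≤ 3 * d) (ω θ φ χ : ℝ) (hθ : 0 ≤ θ) :
    (1 - 36 * ((d : ℝ) * θ) ^ 2) / 4 ≤ shotVar n ω θ φ χ := by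
  have hn' : (n : ℝ) ≤ 3 * d := by exact_mod_cast hn
  have hr : ‖h n ω θ φ χ‖ ≤ 3 * d * θ := (norm_h_le n ω θ φ χ).trans
    ((norm_circuit_zero_one_le n ω θ φ χ hθ).trans (mul_le_mul_of_nonneg_right hn' hθ))
  have hr2 := pow_le_pow_left₀ (norm_nonneg _) hr 2
  rw [shotVar_eq]
  have hcs := Real.sin_sq_add_cos_sq (h n ω θ φ χ).arg
  have hcs4 : Real.cos (h n ω θ φ χ).arg ^ 4 + Real.sin (h n ω θ φ χ).arg ^ 4 ≤ 1 := by
    nlinarith [mul_nonneg (sq_nonneg (Real.sin (h n ω θ φ χ).arg))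
      (sq_nonneg (Real.cos (h n ω θ φ χ).arg))]
  have := mul_le_mul hr2 hcs4 (by positivity) (by positivity)
  linarith

/-! ### The noiseless part of the estimator as a random variable -/

lemma continuous_prob (b : BellInput) (n : ℕ) (θ φ χ : ℝ) :
    Continuous fun ω => prob b n ω θ φ χ := by
  have hz : Continuous zRot := by
    refine continuous_matrix fun i j => ?_
    fin_cases i <;> fin_cases j <;> simp [zRot] <;> fun_prop
  have hc : Continuous fun ω => circuit n ω θ φ χ := (hz.matrix_mul continuous_const).pow n
  have hv : Continuous fun ω => circuit n ω θ φ χ *ᵥ b.state :=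
    hc.matrix_mulVec continuous_const
  exact (((continuous_apply 0).comp hv).norm).pow 2

lemma continuous_h (n : ℕ) (θ φ χ : ℝ) : Continuous fun ω => h n ω θ φ χ := by
  have hX := continuous_prob .X n θ φ χ
  have hY := continuous_prob .Y n θ φ χ
  unfold h reconstruct
  fun_prop

/-- Continuous functions of the prior estimator are known given the prior estimator. -/
lemma stronglyMeasurable_comp_sigmaOf {Ω E : Type*} [TopologicalSpace E]
    [TopologicalSpace.PseudoMetrizableSpace E] {f : ℝ → E} (hf : Continuous f) (φhat : Ω → ℝ) :
    StronglyMeasurable[sigmaOf φhat] fun x => f (φhat x) :=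
  hf.comp_stronglyMeasurable (comap_measurable φhat).stronglyMeasurable

lemma stronglyMeasurable_thetaPd_norm_h {Ω : Type*} (d : ℕ) (θ φ χ : ℝ) (φhat : Ω → ℝ) :
    StronglyMeasurable[sigmaOf φhat] fun x => thetaPd d fun n => ‖h n (φhat x) θ φ χ‖ := by
  refine stronglyMeasurable_comp_sigmaOf (f := fun ω => thetaPd d fun n => ‖h n ω θ φ χ‖) ?_ φhat
  simp only [thetaPd_eq_sum]
  exact continuous_finsetSum _ fun j _ => continuous_const.mul (continuous_h _ θ φ χ).norm

section Signal

variable {Ω : Type*} [MeasurableSpace Ω] {μ : Measure Ω} [IsProbabilityMeasure μ] {φhat : Ω → ℝ}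

lemma memLp_norm_h (n : ℕ) (θ φ χ : ℝ) (hmeas : Measurable φhat) :
    MemLp (fun x => ‖h n (φhat x) θ φ χ‖) 2 μ :=
  MemLp.of_bound (((continuous_h n θ φ χ).norm.measurable.comp hmeas).aestronglyMeasurable) 1
    (Filter.Eventually.of_forall fun x => by rw [norm_norm]; exact norm_h_le_one _ _ _ _ _)

lemma memLp_thetaPd_norm_h (d : ℕ) (θ φ χ : ℝ) (hmeas : Measurable φhat) :
    MemLp (fun x => thetaPd d fun n => ‖h n (φhat x) θ φ χ‖) 2 μ := by
  simp only [thetaPd_eq_sum]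
  exact memLp_finsetSum _ fun j _ => (memLp_norm_h _ θ φ χ hmeas).const_mul _

/-- Averaging the pointwise bound turns the squared detuning into the variance of the unbiased
prior estimator. -/
lemma abs_integral_thetaPd_norm_h_sub_le (d : ℕ) (hd : 1 ≤ d) (θ φ χ : ℝ) (hθ : 0 ≤ θ)
    (hdθ : (d : ℝ) * θ ≤ 1 / 9) (hmeas : Measurable φhat) (hL2 : MemLp φhat 2 μ)
    (hunbiased : ∫ x, φhat x ∂μ = φ) :
    |(∫ x, thetaPd d (fun n => ‖h n (φhat x) θ φ χ‖) ∂μ) - θ|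
      ≤ 13 / 2 * (d : ℝ) ^ 2 * θ * Var[φhat; μ] + 37 * ((d : ℝ) * θ) ^ 3 := by
  have hA : Integrable (fun x => thetaPd d fun n => ‖h n (φhat x) θ φ χ‖) μ :=
    (memLp_thetaPd_norm_h d θ φ χ hmeas).integrable one_le_two
  have hsq : Integrable (fun x => (φhat x - φ) ^ 2) μ := (hL2.sub (memLp_const φ)).integrable_sq
  have e : (∫ x, thetaPd d (fun n => ‖h n (φhat x) θ φ χ‖) ∂μ) - θ
      = ∫ x, (thetaPd d (fun n => ‖h n (φhat x) θ φ χ‖) - θ) ∂μ := by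
    rw [integral_sub hA (integrable_const θ)]
    simp
  rw [e, variance_eq_integral hmeas.aemeasurable, hunbiased]
  calc |∫ x, (thetaPd d (fun n => ‖h n (φhat x) θ φ χ‖) - θ) ∂μ|
      ≤ ∫ x, |thetaPd d (fun n => ‖h n (φhat x) θ φ χ‖) - θ| ∂μ := abs_integral_le_integral_abs
    _ ≤ ∫ x, (13 / 2 * (d : ℝ) ^ 2 * θ * (φhat x - φ) ^ 2 + 37 * ((d : ℝ) * θ) ^ 3) ∂μ :=
      integral_mono (hA.sub (integrable_const θ)).abs
        ((hsq.const_mul _).add (integrable_const _))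
        fun x => abs_thetaPd_norm_h_sub_le d hd (φhat x) θ φ χ hθ hdθ
    _ = 13 / 2 * (d : ℝ) ^ 2 * θ * (∫ x, (φhat x - φ) ^ 2 ∂μ) + 37 * ((d : ℝ) * θ) ^ 3 := by
      rw [integral_add (hsq.const_mul _) (integrable_const _), integral_const_mul]
      simp

/-! ### The linear noise model -/

lemma depth_mem (d j : ℕ) (hj : j ∈ Finset.range (d + 1)) : d + 2 * j ∈ depths d :=
  Finset.mem_image_of_mem (fun k => d + 2 * k) hj

lemma IsAmplitudeData.memLp_integral_condVar {d M : ℕ} (hd : 1 ≤ d) {θ φ χ : ℝ}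
    (hmeas : Measurable φhat) {F : ℕ → Ω → ℝ} (hF : IsAmplitudeData μ d M θ φ χ φhat F) :
    MemLp (fun x => thetaPd d fun n => F n x) 2 μ ∧
      (∫ x, thetaPd d (fun n => F n x) ∂μ
        = ∫ x, thetaPd d (fun n => ‖h n (φhat x) θ φ χ‖) ∂μ) ∧
      Var[fun x => thetaPd d fun n => F n x; μ | sigmaOf φhat]
        =ᵐ[μ] fun _ => 3 / (4 * (M : ℝ) * d * (d + 1) * (d + 2)) := by
  have key := memLp_integral_condVar_of_uncorrelated (μ := μ) hmeas.comap_le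
    (Finset.range (d + 1)) (Y := fun x => thetaPd d fun n => F n x)
    (A := fun x => thetaPd d fun n => ‖h n (φhat x) θ φ χ‖)
    (a := fun j _ => estCoeff d j) (w := fun j => ampNoise θ φ χ φhat F (d + 2 * j))
    (v := fun _ _ => 1 / (4 * (M : ℝ))) (∑ j ∈ Finset.range (d + 1), |estCoeff d j|)
    (by
      ext x
      simp only [thetaPd_eq_sum, ampNoise]
      rw [← Finset.sum_add_distrib]
      exact Finset.sum_congr rfl fun j _ => by ring)
    (stronglyMeasurable_thetaPd_norm_h d θ φ χ φhat) (memLp_thetaPd_norm_h d θ φ χ hmeas)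
    (fun j _ => stronglyMeasurable_const)
    (fun j hj _ => Finset.single_le_sum (f := fun j => |estCoeff d j|)
      (fun _ _ => abs_nonneg _) hj)
    (fun j hj => (hF.memLp _ (depth_mem d j hj)).sub (memLp_norm_h _ θ φ χ hmeas))
    (fun j hj => hF.noise_mean _ (depth_mem d j hj))
    (fun j hj k hk => by
      have h := hF.noise_cov _ (depth_mem d j hj) _ (depth_mem d k hk)
      simpa using h)
  refine ⟨key.1, key.2.1, key.2.2.trans (Filter.Eventually.of_forall fun x => ?_)⟩
  simp only
  rw [← Finset.sum_mul, sum_estCoeff_sq d hd]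
  simp only [div_eq_mul_inv, mul_inv]
  ring

/-! ### The shot noise model -/

lemma IsShotRecord.memLp_integral_condVar {d M : ℕ} (hM : 1 ≤ M) {θ φ χ : ℝ}
    (hmeas : Measurable φhat) {S : BellInput → ℕ → Fin M → Ω → ℝ}
    (hS : IsShotRecord μ d M θ φ χ φhat S) :
    MemLp (fun x => thetaPd d fun n => linAmp θ φ χ φhat S n x) 2 μ ∧
      (∫ x, thetaPd d (fun n => linAmp θ φ χ φhat S n x) ∂μ
        = ∫ x, thetaPd d (fun n => ‖h n (φhat x) θ φ χ‖) ∂μ) ∧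
      Var[fun x => thetaPd d fun n => linAmp θ φ χ φhat S n x; μ | sigmaOf φhat]
        =ᵐ[μ] fun x => ∑ j ∈ Finset.range (d + 1),
          estCoeff d j ^ 2 * (shotVar (d + 2 * j) (φhat x) θ φ χ / M) := by
  classical
  have hM' : (M : ℝ) ≠ 0 := by positivity
  have hXY : BellInput.X ≠ BellInput.Y := by simp
  have hS2 : ∀ b, ∀ n ∈ depths d, ∀ i, MemLp (S b n i) 2 μ := fun b n hn i =>
    MemLp.of_bound (hS.measurable b n hn i).aestronglyMeasurable 1
      (Filter.Eventually.of_forall fun x => by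
        rcases hS.zero_or_one b n hn i x with h | h <;> simp [h])
  have hpm : ∀ b n, StronglyMeasurable[sigmaOf φhat] fun x => prob b n (φhat x) θ φ χ :=
    fun b n => stronglyMeasurable_comp_sigmaOf (continuous_prob b n θ φ χ) φhat
  have hp2 : ∀ b n, MemLp (fun x => prob b n (φhat x) θ φ χ) 2 μ := fun b n =>
    MemLp.of_bound ((hpm b n).mono hmeas.comap_le).aestronglyMeasurable 2
      (Filter.Eventually.of_forall fun x => abs_prob_le_two _ _ _ _ _ _)
  have hmem : ∀ k : ℕ × BellInput × Fin M,
      k ∈ Finset.range (d + 1) ×ˢ (({.X, .Y} : Finset BellInput) ×ˢ Finset.univ) →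
        k.1 ∈ Finset.range (d + 1) := fun k hk => (Finset.mem_product.1 hk).1
  have key := memLp_integral_condVar_of_uncorrelated (μ := μ) hmeas.comap_le
    (Finset.range (d + 1) ×ˢ (({.X, .Y} : Finset BellInput) ×ˢ (Finset.univ : Finset (Fin M))))
    (Y := fun x => thetaPd d fun n => linAmp θ φ χ φhat S n x)
    (A := fun x => thetaPd d fun n => ‖h n (φhat x) θ φ χ‖)
    (a := fun k x => estCoeff d k.1 * (frameCoeff k.2.1 (h (d + 2 * k.1) (φhat x) θ φ χ) / M))
    (w := fun k x => S k.2.1 (d + 2 * k.1) k.2.2 x - prob k.2.1 (d + 2 * k.1) (φhat x) θ φ χ)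
    (v := fun k x => prob k.2.1 (d + 2 * k.1) (φhat x) θ φ χ
      * (1 - prob k.2.1 (d + 2 * k.1) (φhat x) θ φ χ))
    ((∑ j ∈ Finset.range (d + 1), |estCoeff d j|) * (1 / M))
    (by
      ext x
      simp only [thetaPd_eq_sum, linAmp_eq hM]
      rw [Finset.sum_product, ← Finset.sum_add_distrib]
      refine Finset.sum_congr rfl fun j _ => ?_
      rw [Finset.sum_product, Finset.sum_pair hXY, mul_add, mul_add, Finset.mul_sum,
        Finset.mul_sum]
      simp only [mul_assoc])
    (stronglyMeasurable_thetaPd_norm_h d θ φ χ φhat) (memLp_thetaPd_norm_h d θ φ χ hmeas)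
    (fun k _ => by
      have hm : Measurable fun ω => frameCoeff k.2.1 (h (d + 2 * k.1) ω θ φ χ) :=
        (measurable_frameCoeff _).comp (continuous_h _ θ φ χ).measurable
      exact (((hm.comp (comap_measurable φhat)).div_const _).const_mul _).stronglyMeasurable)
    (fun k hk x => by
      rw [abs_mul, abs_div, Nat.abs_cast]
      refine mul_le_mul (Finset.single_le_sum (f := fun j => |estCoeff d j|)
        (fun _ _ => abs_nonneg _) (hmem k hk)) ?_ (by positivity)
        (Finset.sum_nonneg fun _ _ => abs_nonneg _)
      exact div_le_div_of_nonneg_right (abs_frameCoeff_le_one _ _) (Nat.cast_nonneg M))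
    (fun k hk => (hS2 _ _ (depth_mem d _ (hmem k hk)) _).sub (hp2 _ _))
    (fun k hk => by
      have hd := depth_mem d _ (hmem k hk)
      filter_upwards [condExp_sub ((hS2 k.2.1 _ hd k.2.2).integrable one_le_two)
        ((hp2 k.2.1 (d + 2 * k.1)).integrable one_le_two) (sigmaOf φhat),
        hS.prob_eq k.2.1 _ hd k.2.2] with x h1 h2
      rw [condExp_of_stronglyMeasurable hmeas.comap_le (hpm _ _)
        ((hp2 _ _).integrable one_le_two), Pi.sub_apply, h2, sub_self] at h1
      exact h1)
    (fun k hk l hl => by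
      have hdk := depth_mem d _ (hmem k hk)
      have hdl := depth_mem d _ (hmem l hl)
      by_cases hkl : k = l
      · subst hkl
        -- a `0/1`-valued variable is its own square
        have hsq : (fun x => S k.2.1 (d + 2 * k.1) k.2.2 x * S k.2.1 (d + 2 * k.1) k.2.2 x)
            = S k.2.1 (d + 2 * k.1) k.2.2 := by
          ext x
          rcases hS.zero_or_one k.2.1 _ hdk k.2.2 x with h | h <;> simp [h]
        have hp := hS.prob_eq k.2.1 _ hdk k.2.2
        have hq := hp
        rw [← hsq] at hq
        have := condExp_centred_mul hmeas.comap_le (hS2 k.2.1 _ hdk k.2.2) (hS2 k.2.1 _ hdk k.2.2)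
          (hpm _ _) (hpm _ _) (hp2 _ _) (hp2 _ _) hp hp hq
        filter_upwards [this] with x hx
        rw [hx, if_pos rfl]
        ring
      · have hne : (k.2.1, d + 2 * k.1, k.2.2) ≠ (l.2.1, d + 2 * l.1, l.2.2) := fun h => by
          simp only [Prod.mk.injEq] at h
          exact hkl (Prod.ext (by omega) (Prod.ext h.1 h.2.2))
        have := condExp_centred_mul hmeas.comap_le (hS2 k.2.1 _ hdk k.2.2) (hS2 l.2.1 _ hdl l.2.2)
          (hpm _ _) (hpm _ _) (hp2 _ _) (hp2 _ _) (hS.prob_eq k.2.1 _ hdk k.2.2)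
          (hS.prob_eq l.2.1 _ hdl l.2.2) (hS.pair_indep _ _ hdk _ _ _ hdl _ hne)
        filter_upwards [this] with x hx
        rw [hx, if_neg hkl, sub_self])
  refine ⟨key.1, key.2.1, key.2.2.trans (Filter.Eventually.of_forall fun x => ?_)⟩
  simp only
  rw [Finset.sum_product]
  refine Finset.sum_congr rfl fun j _ => ?_
  rw [Finset.sum_product, Finset.sum_pair hXY]
  simp only [Finset.sum_const, Finset.card_univ, Fintype.card_fin, nsmul_eq_mul]
  rw [shotVar]
  field_simp

end Signal

end QSPC

theorem mainTheorem8 (d M : ℕ) (hd : 1 ≤ d) (hM : 1 ≤ M) (θ φ χ : ℝ) (hθ : 0 ≤ θ)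
    (hdθ : (d : ℝ) * θ ≤ 1 / 9)
    {Ω : Type*} [MeasurableSpace Ω] (μ : Measure Ω) [IsProbabilityMeasure μ]
    (φhat : Ω → ℝ) (hmeas : Measurable φhat) (hL2 : MemLp φhat 2 μ)
    (hunbiased : ∫ x, φhat x ∂μ = φ) :
    (∀ F : ℕ → Ω → ℝ, QSPC.IsAmplitudeData μ d M θ φ χ φhat F →
      MemLp (fun x => QSPC.thetaPd d fun n => F n x) 2 μ ∧
      |(∫ x, QSPC.thetaPd d (fun n => F n x) ∂μ) - θ|
        ≤ 13 / 2 * (d : ℝ) ^ 2 * θ * Var[φhat; μ] + 37 * ((d : ℝ) * θ) ^ 3 ∧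
      Var[fun x => QSPC.thetaPd d fun n => F n x; μ | QSPC.sigmaOf φhat]
        =ᵐ[μ] fun _ => 3 / (4 * (M : ℝ) * d * (d + 1) * (d + 2))) ∧
    (∀ S : QSPC.BellInput → ℕ → Fin M → Ω → ℝ, QSPC.IsShotRecord μ d M θ φ χ φhat S →
      MemLp (fun x => QSPC.thetaPd d fun n => QSPC.linAmp θ φ χ φhat S n x) 2 μ ∧
      |(∫ x, QSPC.thetaPd d (fun n => QSPC.linAmp θ φ χ φhat S n x) ∂μ) - θ|
        ≤ 13 / 2 * (d : ℝ) ^ 2 * θ * Var[φhat; μ] + 37 * ((d : ℝ) * θ) ^ 3 ∧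
      ∀ᵐ x ∂μ,
        (1 - 36 * ((d : ℝ) * θ) ^ 2) * (3 / (4 * (M : ℝ) * d * (d + 1) * (d + 2)))
          ≤ Var[fun x => QSPC.thetaPd d fun n => QSPC.linAmp θ φ χ φhat S n x; μ |
              QSPC.sigmaOf φhat] x ∧
        Var[fun x => QSPC.thetaPd d fun n => QSPC.linAmp θ φ χ φhat S n x; μ |
              QSPC.sigmaOf φhat] x
          ≤ 3 / (4 * (M : ℝ) * d * (d + 1) * (d + 2))) := by
  have hbias := QSPC.abs_integral_thetaPd_norm_h_sub_le d hd θ φ χ hθ hdθ hmeas hL2 hunbiased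
  refine ⟨fun F hF => ?_, fun S hS => ?_⟩
  · obtain ⟨h1, h2, h3⟩ := hF.memLp_integral_condVar hd hmeas
    exact ⟨h1, h2 ▸ hbias, h3⟩
  · obtain ⟨h1, h2, h3⟩ := hS.memLp_integral_condVar hM hmeas
    refine ⟨h1, h2 ▸ hbias, ?_⟩
    have hM0 : (0 : ℝ) < M := by exact_mod_cast hM
    have hsum : ∀ t : ℝ, t * (3 / (4 * (M : ℝ) * d * (d + 1) * (d + 2)))
        = ∑ j ∈ Finset.range (d + 1), QSPC.estCoeff d j ^ 2 * (t / 4 / M) := fun t => by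
      rw [← Finset.sum_mul, QSPC.sum_estCoeff_sq d hd]
      simp only [div_eq_mul_inv, mul_inv]
      ring
    filter_upwards [h3] with x hx
    rw [hx]
    constructor
    · rw [hsum]
      refine Finset.sum_le_sum fun j hj => mul_le_mul_of_nonneg_left
        (div_le_div_of_nonneg_right (QSPC.le_shotVar d _ ?_ _ θ φ χ hθ) hM0.le) (sq_nonneg _)
      have := Finset.mem_range.1 hj
      omega
    · rw [← one_mul (3 / _), hsum]
      exact Finset.sum_le_sum fun j _ => mul_le_mul_of_nonneg_left
        (div_le_div_of_nonneg_right (QSPC.shotVar_le _ _ θ φ χ) hM0.le) (sq_nonneg _)
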